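/- Let $(M,d)$ be a metric space. Call $E\subset M\times M$ controlled if $\sup_{(x,y)\in E}d(x,y)<\infty$, and for bounded $f:M\to\mathbf C$ put $\nabla_Ef(x)=\sup\{|f(x)-f(y)| : (x,y)\in E\}$ (with $\sup\emptyset=0$). Let $C_\nu(M)$ be the algebra of all bounded continuous $f:M\to\mathbf C$ such that $\nabla_Ef$ vanishes at infinity (tends to $0$ outside compact sets) for every controlled $E$, with the supremum norm. The Higson compactification $M^\nu$ is the maximal ideal space of $C_\nu(M)$, i.e. the space of its characters with the Gelfand (weak-*) topology; a point $x\in M$ is regarded as a point of $M^\nu$ through the evaluation $f\mapsto f(x)$. A map $f:M\to M'$ of metric spaces is coarse if for each $R>0$ there is $S>0$ such that $d(x,z)\le R$ implies $d'(f(x),f(z))\le S$, and preimages of bounded sets are bounded. It is a coarse equivalence if it is coarse and there is a coarse map $g:M'\to M$ such that $g\circ f$ and $f\circ g$ are at bounded distance from the identity maps; $M$ and $M'$ are coarsely equivalent if such an $f$ exists. A net in $M$ is a subset $A\subset M$ such that for some $K>0$ every point of $M$ is within distance $K$ of a point of $A$. A coarse quasi-isometry between $M$ and $M'$ is a bi-Lipschitz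 bijection $A\to A'$ between a net $A\subset M$ and a net $A'\subset M'$. $M$ is coarsely quasi-convex if there are constants $a,b,c>0$ such that any $x,y\in M$ can be joined by a finite sequence $x=x_0,\dots,x_n=y$ in $M$ with $d(x_{k-1},x_k)\le c$ for all $k$ and $\sum_{k=1}^n d(x_{k-1},x_k)\le a\,d(x,y)+b$. **Theorem.** Let $(M,d)$ and $(M',d')$ be proper metric spaces (closed balls are compact) and let $\varphi:C_\nu(M')\to C_\nu(M)$ be an isomorphism of complex algebras (no continuity or compatibility with complex conjugation is assumed). Then $M$ and $M'$ are coarsely equivalent. More precisely, $\varphi$ induces a homeomorphism $F:M^\nu\to M'^\nu$, $F(\chi)=\chi\circ\varphi$, which maps $M$ onto $M'$, and the restriction $h:M\to M'$ of $F$ is a homeomorphism and a coarse equivalence. If moreover $M$ and $M'$ are coarsely quasi-convex, then $\varphi$ induces a coarse quasi-isometry between $M$ and $M'$: there are nets $A\subset M$ and $A'\subset M'$ such that $h$ restricts to a bi-Lipschitz bijection $A\to A'$. -/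

import Mathlib

open Filter Topology
open scoped BoundedContinuousFunction

namespace HigsonCoarse

universe u v w

section Coarse

variable {M : Type u} {M' : Type v} [MetricSpace M] [MetricSpace M']

/-- Two maps from a set into a metric space are close if they are at bounded distance. -/
def Close {S : Type w} (f g : S → M) : Prop :=
  ∃ R : ℝ, ∀ s : S, dist (f s) (g s) ≤ R

/-- Controlled sets of the metric coarse structure: the two projections, restricted to `E`,
are close. -/
def Controlled (E : Set (M × M)) : Prop :=
  Close (fun p : E => p.1.1) (fun p : E => p.1.2)

/-- Uniformly expansive maps. -/
def UniformlyExpansive (f : M → M') : Prop :=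
  ∀ R > (0 : ℝ), ∃ S > (0 : ℝ), ∀ x z : M, dist x z ≤ R → dist (f x) (f z) ≤ S

/-- Metrically proper maps. -/
def MetricallyProper (f : M → M') : Prop :=
  ∀ B : Set M', Bornology.IsBounded B → Bornology.IsBounded (f ⁻¹' B)

/-- Coarse maps between metric spaces (not necessarily continuous). -/
structure IsCoarseMap (f : M → M') : Prop where
  uniformlyExpansive : UniformlyExpansive f
  metricallyProper : MetricallyProper f

/-- Coarse equivalences: coarse maps with a coarse inverse up to closeness. -/
def IsCoarseEquivalence (f : M → M') : Prop :=
  IsCoarseMap f ∧ ∃ g : M' → M, IsCoarseMap g ∧ Close (g ∘ f) id ∧ Close (f ∘ g) id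

variable (M M') in
/-- `M` and `M'` are coarsely equivalent. -/
def CoarselyEquivalent : Prop :=
  ∃ f : M → M', IsCoarseEquivalence f

/-- A net in a metric space: all points are within some fixed distance of `A`. -/
def IsNet (A : Set M) : Prop :=
  ∃ K > (0 : ℝ), ∀ x : M, ∃ a ∈ A, dist x a ≤ K

variable (M M') in
/-- A coarse quasi-isometry: a bi-Lipschitz bijection between a net of `M` and a net of `M'`. -/
structure CoarseQuasiIsometry where
  source : Set M
  target : Set M'
  isNet_source : IsNet source
  isNet_target : IsNet target
  toEquiv : source ≃ target
  biLipschitz : ∃ C : ℝ, 1 ≤ C ∧ ∀ x y : source,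
    (1 / C) * dist x y ≤ dist (toEquiv x) (toEquiv y) ∧
      dist (toEquiv x) (toEquiv y) ≤ C * dist x y

variable (M) in
/-- Coarsely quasi-convex metric spaces. The finite sequence is `x 0, …, x n`. -/
def CoarselyQuasiConvex : Prop :=
  ∃ a > (0 : ℝ), ∃ b > (0 : ℝ), ∃ c > (0 : ℝ), ∀ p q : M, ∃ (n : ℕ) (x : ℕ → M),
    x 0 = p ∧ x n = q ∧ (∀ k < n, dist (x k) (x (k + 1)) ≤ c) ∧
      ∑ k ∈ Finset.range n, dist (x k) (x (k + 1)) ≤ a * dist p q + b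

end Coarse

section Higson

variable {M : Type u} [MetricSpace M]

/-- The `E`-expansion `∇_E f (x) = sup {|f x - f y| : (x, y) ∈ E}` (it is `0` when there is
no such `y`). -/
noncomputable def expansion (E : Set (M × M)) (f : M → ℂ) (x : M) : ℝ :=
  sSup ((fun y => ‖f x - f y‖) '' {y | (x, y) ∈ E})

/-- The condition defining Higson functions, for a bounded function `f`: every expansion along
a controlled set vanishes at infinity. -/
def IsHigson (f : M → ℂ) : Prop :=
  ∀ E : Set (M × M), Controlled E → Tendsto (expansion E f) (cocompact M) (𝓝 0)

theorem isHigson_iff (f : M →ᵇ ℂ) :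
    IsHigson f ↔ ∀ E : Set (M × M), Controlled E → ∀ ε > (0 : ℝ),
      ∀ᶠ x in cocompact M, ∀ y, (x, y) ∈ E → ‖f x - f y‖ ≤ ε := by
  refine forall_congr' fun E => imp_congr_right fun _ => ?_
  have hnn : ∀ x, 0 ≤ expansion E f x := fun x =>
    Real.sSup_nonneg (by rintro _ ⟨y, -, rfl⟩; positivity)
  constructor
  · intro h ε hε
    filter_upwards [h.eventually (gt_mem_nhds hε)] with x hx y hy
    have hb : BddAbove ((fun y => ‖f x - f y‖) '' {y | (x, y) ∈ E}) := by
      refine ⟨2 * ‖f‖, ?_⟩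
      rintro _ ⟨z, -, rfl⟩
      exact (dist_eq_norm (f x) (f z)).symm.le.trans (f.dist_le_two_norm x z)
    exact (le_csSup hb ⟨y, hy, rfl⟩).trans hx.le
  · intro h
    rw [Metric.tendsto_nhds]
    intro ε hε
    filter_upwards [h (ε / 2) (half_pos hε)] with x hx
    rw [Real.dist_eq, sub_zero, abs_of_nonneg (hnn x)]
    refine lt_of_le_of_lt (Real.sSup_le ?_ (half_pos hε).le) (half_lt_self hε)
    rintro _ ⟨y, hy, rfl⟩
    exact hx y hy

variable (M) in
/-- The algebra `C_ν(M)` of bounded continuous Higson functions, with the supremum norm. -/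
noncomputable def higsonAlgebra : Subalgebra ℂ (M →ᵇ ℂ) where
  carrier := {f | IsHigson f}
  add_mem' := by
    intro f g hf hg
    rw [Set.mem_ofPred_eq, isHigson_iff] at *
    intro E hE ε hε
    filter_upwards [hf E hE (ε / 2) (half_pos hε), hg E hE (ε / 2) (half_pos hε)]
      with x hx hx' y hy
    have h : (f + g) x - (f + g) y = (f x - f y) + (g x - g y) := by
      simp only [BoundedContinuousFunction.coe_add, Pi.add_apply]; ring
    rw [h]
    linarith [norm_add_le (f x - f y) (g x - g y), hx y hy, hx' y hy]
  mul_mem' := by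
    intro f g hf hg
    rw [Set.mem_ofPred_eq, isHigson_iff] at *
    intro E hE ε hε
    have hc : 0 < ‖f‖ + ‖g‖ + 1 := by positivity
    have hd : 0 < ε / (‖f‖ + ‖g‖ + 1) := div_pos hε hc
    filter_upwards [hf E hE _ hd, hg E hE _ hd] with x hx hx' y hy
    have h : (f * g) x - (f * g) y = f x * (g x - g y) + (f x - f y) * g y := by
      simp only [BoundedContinuousFunction.coe_mul, Pi.mul_apply]; ring
    rw [h]
    calc ‖f x * (g x - g y) + (f x - f y) * g y‖
        ≤ ‖f x‖ * ‖g x - g y‖ + ‖f x - f y‖ * ‖g y‖ := by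
          rw [← norm_mul, ← norm_mul]; exact norm_add_le _ _
      _ ≤ ‖f‖ * (ε / (‖f‖ + ‖g‖ + 1)) + (ε / (‖f‖ + ‖g‖ + 1)) * ‖g‖ := by
          gcongr
          · exact f.norm_coe_le_norm x
          · exact hx' y hy
          · exact hx y hy
          · exact g.norm_coe_le_norm y
      _ ≤ (‖f‖ + ‖g‖ + 1) * (ε / (‖f‖ + ‖g‖ + 1)) := by nlinarith
      _ = ε := by field_simp
  algebraMap_mem' := by
    intro c
    rw [Set.mem_ofPred_eq, isHigson_iff]
    intro E _ ε hε
    refine Eventually.of_forall fun x y _ => ?_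
    simpa using hε.le

variable (M) in
/-- The Higson compactification: the maximal ideal space of `C_ν(M)`, realised as its space of
characters with the weak-* (Gelfand) topology. -/
abbrev HigsonCompactification : Type u :=
  WeakDual.characterSpace ℂ (higsonAlgebra M)

/-- The canonical map of `M` into its Higson compactification, sending a point to the evaluation
at that point. -/
noncomputable def toHigson (x : M) : HigsonCompactification M :=
  ⟨((BoundedContinuousFunction.evalCLM ℂ x).comp
      (higsonAlgebra M).toSubmodule.subtypeL : higsonAlgebra M →L[ℂ] ℂ), by
    constructor
    · intro h
      have h1 : (1 : ℂ) = 0 := DFunLike.congr_fun h (1 : higsonAlgebra M)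
      exact one_ne_zero h1
    · intro f g
      rfl⟩

@[simp]
theorem toHigson_apply (x : M) (f : higsonAlgebra M) : toHigson x f = (f : M →ᵇ ℂ) x := rfl

end Higson

end HigsonCoarse

open HigsonCoarse

namespace HigsonCoarse

/-! ### Construction of Higson functions. -/

section Functions

variable {X : Type*} [MetricSpace X]

/-! Points of `M` are recognised by ideals. If `t` is the truncated distance to `x` and `k x ≠ 0`,
then `t` and `k` generate the unit ideal. Let `φ g = t`; since unit ideals pass through `φ`, any `k`
with zeros where `g` is arbitrarily small satisfies `φ k x = 0` (`apply_eq_zero_of_common_zeros`).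
If `g` vanishes at `y`, applying this to `f - f y` gives `φ f x = f y`. If `g` has no zero, it is
still not invertible, so it tends to `0` along a sequence escaping to infinity. Two mutually
diverging sequences taken from it are separated infinitely often by a Higson function `f`
(`exists_separating`). Then both `f` and `f - 1` qualify as `k`, so `φ f x` is both `0` and `1`.
Hence `φ` is composition with a homeomorphism `h`, so it is isometric and acts on characters. If `h`
were not uniformly expansive, pairs at bounded distance would have diverging images; a function
separating the images would pull back to a non-Higson function. In the quasi-convex case, chains
upgrade expansiveness to affine bounds, and a sufficiently sparse net absorbs the additive
constants. -/

theorem isHigson_iff_dist (f : X →ᵇ ℂ) :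
    IsHigson f ↔ ∀ R : ℝ, ∀ ε > (0 : ℝ),
      ∀ᶠ x in cocompact X, ∀ y, dist x y ≤ R → ‖f x - f y‖ ≤ ε := by
  rw [isHigson_iff]
  constructor
  · intro h R ε hε
    exact h {p | dist p.1 p.2 ≤ R} ⟨R, fun s => s.2⟩ ε hε
  · rintro h E ⟨R, hR⟩ ε hε
    filter_upwards [h R ε hε] with x hx y hy
    exact hx y (hR ⟨(x, y), hy⟩)

theorem star_mem_higsonAlgebra {f : X →ᵇ ℂ} (hf : f ∈ higsonAlgebra X) :
    star f ∈ higsonAlgebra X := by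
  refine (isHigson_iff_dist _).2 fun R ε hε => ?_
  filter_upwards [(isHigson_iff_dist f).1 hf R ε hε] with x hx y hy
  rw [BoundedContinuousFunction.star_apply, BoundedContinuousFunction.star_apply, ← star_sub,
    norm_star]
  exact hx y hy

/-- A Higson function that is bounded away from zero is invertible in the Higson algebra. -/
theorem exists_mul_eq_one (f : higsonAlgebra X) {δ : ℝ} (hδ : 0 < δ)
    (hf : ∀ x, δ ≤ ‖(f : X →ᵇ ℂ) x‖) : ∃ g : higsonAlgebra X, f * g = 1 := by
  have hne : ∀ x, (f : X →ᵇ ℂ) x ≠ 0 := fun x => norm_pos_iff.1 (hδ.trans_le (hf x))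
  let g : X →ᵇ ℂ := BoundedContinuousFunction.ofNormedAddCommGroup
    (fun x => ((f : X →ᵇ ℂ) x)⁻¹) ((f : X →ᵇ ℂ).continuous.inv₀ hne) δ⁻¹ (fun x => by
      rw [norm_inv]; exact inv_anti₀ hδ (hf x))
  have hg : g ∈ higsonAlgebra X := by
    refine (isHigson_iff_dist _).2 fun R ε hε => ?_
    filter_upwards [(isHigson_iff_dist _).1 f.2 R (ε * (δ * δ)) (by positivity)] with x hx y hy
    change ‖((f : X →ᵇ ℂ) x)⁻¹ - ((f : X →ᵇ ℂ) y)⁻¹‖ ≤ ε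
    rw [inv_sub_inv (hne x) (hne y), norm_div, norm_mul, norm_sub_rev]
    refine div_le_of_le_mul₀ (by positivity) hε.le ((hx y hy).trans ?_)
    gcongr
    · exact hf x
    · exact hf y
  refine ⟨⟨g, hg⟩, ?_⟩
  ext x
  exact mul_inv_cancel₀ (hne x)

/-- Two Higson functions without approximate common zeros generate the unit ideal. -/
theorem exists_add_eq_one (f k : higsonAlgebra X) {δ : ℝ} (hδ : 0 < δ)
    (hfk : ∀ x, δ ≤ ‖(f : X →ᵇ ℂ) x‖ ∨ δ ≤ ‖(k : X →ᵇ ℂ) x‖) :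
    ∃ u v : higsonAlgebra X, u * f + v * k = 1 := by
  let f' : higsonAlgebra X := ⟨star f, star_mem_higsonAlgebra f.2⟩
  let k' : higsonAlgebra X := ⟨star k, star_mem_higsonAlgebra k.2⟩
  -- The sum is `|f|² + |k|² ≥ δ²`, so the coefficients are the conjugates divided by it.
  obtain ⟨g, hg⟩ := exists_mul_eq_one (f * f' + k * k') (pow_pos hδ 2) (fun x => by
    have h : ((f * f' + k * k' : higsonAlgebra X) : X →ᵇ ℂ) x =
        ((‖(f : X →ᵇ ℂ) x‖ ^ 2 + ‖(k : X →ᵇ ℂ) x‖ ^ 2 : ℝ) : ℂ) := by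
      change (f : X →ᵇ ℂ) x * (starRingEnd ℂ) ((f : X →ᵇ ℂ) x) +
        (k : X →ᵇ ℂ) x * (starRingEnd ℂ) ((k : X →ᵇ ℂ) x) = _
      rw [Complex.mul_conj', Complex.mul_conj']
      push_cast
      rfl
    rw [h, Complex.norm_real, Real.norm_of_nonneg (by positivity)]
    rcases hfk x with h | h
    · nlinarith [sq_nonneg ‖(k : X →ᵇ ℂ) x‖]
    · nlinarith [sq_nonneg ‖(f : X →ᵇ ℂ) x‖])
  exact ⟨f' * g, k' * g, by rw [← hg]; ring⟩

/-- The truncated distance `min (dist x ·) 1` as a Higson function. -/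
theorem exists_truncated_dist [ProperSpace X] (x : X) :
    ∃ f : higsonAlgebra X, ∀ y, (f : X →ᵇ ℂ) y = ((min (dist x y) 1 : ℝ) : ℂ) := by
  let f : X →ᵇ ℂ := BoundedContinuousFunction.ofNormedAddCommGroup
    (fun y => ((min (dist x y) 1 : ℝ) : ℂ)) (by fun_prop) 1 (fun y => by
      rw [Complex.norm_real, Real.norm_of_nonneg (by positivity)]
      exact min_le_right _ _)
  refine ⟨⟨f, (isHigson_iff_dist _).2 fun R ε hε => ?_⟩, fun y => rfl⟩
  filter_upwards [(tendsto_dist_left_cocompact_atTop x).eventually_ge_atTop (R + 1),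
    (tendsto_dist_left_cocompact_atTop x).eventually_ge_atTop 1] with y hy hy1 z hz
  change ‖((min (dist x y) 1 : ℝ) : ℂ) - ((min (dist x z) 1 : ℝ) : ℂ)‖ ≤ ε
  have h2 := dist_triangle x z y
  rw [dist_comm z y] at h2
  rw [min_eq_right hy1, min_eq_right (by linarith), sub_self, norm_zero]
  exact hε.le

/-- The supremum of cones over points `b n`, of radii `r n` increasing to infinity, is a Higson
function. -/
theorem exists_higson_bumps [ProperSpace X] (b : ℕ → X) (r : ℕ → ℝ) (hr0 : ∀ n, 0 < r n)
    (hr : Monotone r) (hrt : Tendsto r atTop atTop) :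
    ∃ f : higsonAlgebra X, (∀ n, (f : X →ᵇ ℂ) (b n) = 1) ∧
      ∀ a, (∀ n, r n ≤ dist a (b n)) → (f : X →ᵇ ℂ) a = 0 := by
  let β : ℕ → X → ℝ := fun n y => max 0 (1 - dist y (b n) / r n)
  have hβ0 : ∀ n y, 0 ≤ β n y := fun n y => le_max_left _ _
  have hβ1 : ∀ n y, β n y ≤ 1 := fun n y => max_le zero_le_one (by
    have := div_nonneg (dist_nonneg (x := y) (y := b n)) (hr0 n).le
    linarith)
  have hβv : ∀ n y, r n ≤ dist y (b n) → β n y = 0 := fun n y h => by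
    refine max_eq_left ?_
    have := (one_le_div (hr0 n)).2 h
    linarith
  have hβL : ∀ n y z, β n y ≤ β n z + dist y z / r n := by
    intro n y z
    have h1 : dist z (b n) / r n ≤ dist y (b n) / r n + dist y z / r n := by
      rw [← add_div]
      have := hr0 n
      gcongr
      have := dist_triangle z y (b n)
      rw [dist_comm z y] at this
      linarith
    have h2 : 0 ≤ dist y z / r n := div_nonneg dist_nonneg (hr0 n).le
    refine max_le (add_nonneg (hβ0 n z) h2) ?_
    have := le_max_right 0 (1 - dist z (b n) / r n)
    change 1 - dist z (b n) / r n ≤ β n z at this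
    linarith
  let F : X → ℝ := fun y => ⨆ n, β n y
  have hbdd : ∀ y, BddAbove (Set.range fun n => β n y) := fun y =>
    ⟨1, by rintro _ ⟨n, rfl⟩; exact hβ1 n y⟩
  have hF0 : ∀ y, 0 ≤ F y := fun y => Real.iSup_nonneg fun n => hβ0 n y
  have hF1 : ∀ y, F y ≤ 1 := fun y => ciSup_le fun n => hβ1 n y
  -- Where the first `N` cones vanish, only cones of slope at most `1 / r N` contribute: the
  -- function flattens towards infinity.
  have hlip : ∀ N y z, (∀ n < N, β n y = 0) → F y ≤ F z + dist y z / r N := by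
    intro N y z h
    refine ciSup_le fun n => ?_
    rcases lt_or_ge n N with hn | hn
    · rw [h n hn]
      exact add_nonneg (hF0 z) (div_nonneg dist_nonneg (hr0 N).le)
    · refine (hβL n y z).trans (add_le_add (le_ciSup (hbdd z) n) ?_)
      exact div_le_div_of_nonneg_left dist_nonneg (hr0 N) (hr hn)
  have habs : ∀ N y z, (∀ n < N, β n y = 0) → (∀ n < N, β n z = 0) →
      |F y - F z| ≤ dist y z / r N := by
    intro N y z hy hz
    have h1 := hlip N y z hy
    have h2 := hlip N z y hz
    rw [dist_comm z y] at h2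
    rw [abs_le]
    constructor <;> linarith
  have hcont : Continuous F := by
    refine (LipschitzWith.of_dist_le_mul (K := (r 0)⁻¹.toNNReal) fun y z => ?_).continuous
    rw [Real.dist_eq, Real.coe_toNNReal _ (inv_nonneg.2 (hr0 0).le), ← div_eq_inv_mul]
    exact habs 0 y z (by simp) (by simp)
  let f : X →ᵇ ℂ := BoundedContinuousFunction.ofNormedAddCommGroup
    (fun y => ((F y : ℝ) : ℂ)) (by fun_prop) 1 (fun y => by
      rw [Complex.norm_real, Real.norm_of_nonneg (hF0 y)]
      exact hF1 y)
  refine ⟨⟨f, (isHigson_iff_dist _).2 fun R ε hε => ?_⟩, fun n => ?_, fun a ha => ?_⟩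
  · obtain ⟨N, hN⟩ := (hrt.eventually_ge_atTop (R / ε)).exists
    have hev : ∀ᶠ x in cocompact X, ∀ n < N, r n + R ≤ dist x (b n) ∧ r n ≤ dist x (b n) := by
      refine (Set.finite_lt_nat N).eventually_all.2 fun n _ => ?_
      exact ((tendsto_dist_right_cocompact_atTop (b n)).eventually_ge_atTop _).and
        ((tendsto_dist_right_cocompact_atTop (b n)).eventually_ge_atTop _)
    filter_upwards [hev] with x hx y hy
    change ‖((F x : ℝ) : ℂ) - ((F y : ℝ) : ℂ)‖ ≤ ε
    rw [← Complex.ofReal_sub, Complex.norm_real, Real.norm_eq_abs]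
    refine (habs N x y (fun n hn => hβv n x (hx n hn).2) fun n hn => hβv n y ?_).trans ?_
    · have := dist_triangle x y (b n)
      linarith [(hx n hn).1]
    · rw [div_le_iff₀ hε] at hN
      rw [div_le_iff₀ (hr0 N)]
      linarith
  · change ((F (b n) : ℝ) : ℂ) = 1
    have : F (b n) = 1 := le_antisymm (hF1 _) (le_ciSup_of_le (hbdd _) n (by simp [β]))
    rw [this, Complex.ofReal_one]
  · change ((F a : ℝ) : ℂ) = 0
    have : F a = 0 := by simp [F, hβv _ a (ha _)]
    rw [this, Complex.ofReal_zero]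

/-- Sequences that go to infinity and diverge from each other are separated, along a
subsequence, by a Higson function. -/
theorem exists_separating [ProperSpace X] (a b : ℕ → X) (ha : Tendsto a atTop (cocompact X))
    (hb : Tendsto b atTop (cocompact X)) (hab : Tendsto (fun n => dist (a n) (b n)) atTop atTop) :
    ∃ f : higsonAlgebra X, ∃ᶠ n in atTop, (f : X →ᵇ ℂ) (a n) = 0 ∧ (f : X →ᵇ ℂ) (b n) = 1 := by
  let p := a 0
  -- The first bound makes the cone at `b n` vanish at `a n`; the second keeps it away from earlier,
  -- much closer points `a m`.
  let ρ : ℕ → ℝ := fun n => min (dist (a n) (b n)) (dist p (b n) / 2)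
  have hpa : Tendsto (fun n => dist p (a n)) atTop atTop :=
    (tendsto_dist_left_cocompact_atTop p).comp ha
  have hpb : Tendsto (fun n => dist p (b n)) atTop atTop :=
    (tendsto_dist_left_cocompact_atTop p).comp hb
  have hρ : Tendsto ρ atTop atTop :=
    tendsto_atTop.2 fun R => by
      filter_upwards [hab.eventually_ge_atTop R,
        (hpb.atTop_div_const two_pos).eventually_ge_atTop R] with n h1 h2
      exact le_min h1 h2
  obtain ⟨σ, hσ0, hσ⟩ := exists_seq_of_forall_finset_exists (fun n => 0 < ρ n)
    (fun m n => m < n ∧ ρ m + 1 ≤ ρ n ∧ 2 * dist p (a m) ≤ dist p (b n) ∧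
      dist p (b m) + ρ m ≤ dist p (a n)) (fun s _ => by
      have hev : ∀ᶠ n in atTop, ∀ m ∈ s, m < n ∧ ρ m + 1 ≤ ρ n ∧
          2 * dist p (a m) ≤ dist p (b n) ∧ dist p (b m) + ρ m ≤ dist p (a n) := by
        refine s.eventually_all.2 fun m _ => ?_
        exact (eventually_gt_atTop m).and ((hρ.eventually_ge_atTop _).and
          ((hpb.eventually_ge_atTop _).and (hpa.eventually_ge_atTop _)))
      exact ((hρ.eventually_gt_atTop 0).and hev).exists)
  have hmono : StrictMono σ := fun m n h => (hσ m n h).1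
  have hrm : StrictMono (ρ ∘ σ) := fun m n h => by
    have := (hσ m n h).2.1
    simp only [Function.comp]
    linarith
  obtain ⟨f, hf1, hf0⟩ := exists_higson_bumps (b ∘ σ) (ρ ∘ σ) hσ0 hrm.monotone
    (hρ.comp hmono.tendsto_atTop)
  refine ⟨f, frequently_atTop.2 fun N => ⟨σ N, hmono.le_apply, hf0 _ fun n => ?_, hf1 N⟩⟩
  simp only [Function.comp]
  have h2 : ρ (σ n) ≤ dist p (b (σ n)) / 2 := min_le_right _ _
  rcases lt_trichotomy N n with h | rfl | h
  · have := (hσ N n h).2.2.1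
    have := dist_triangle p (a (σ N)) (b (σ n))
    linarith
  · exact min_le_left _ _
  · have := (hσ n N h).2.2.2
    have := dist_triangle p (b (σ n)) (a (σ N))
    rw [dist_comm (b (σ n))] at this
    linarith

end Functions

/-! ### Recovering points and the coarse structure from the algebra. -/

section Points

variable {M : Type*} {M' : Type*} [MetricSpace M] [MetricSpace M']

/-- If `φ g` is the truncated distance to `x`, then Higson functions having approximate common
zeros with `g` are sent to functions vanishing at `x`. -/
theorem apply_eq_zero_of_common_zeros (φ : higsonAlgebra M' ≃ₐ[ℂ] higsonAlgebra M) (x : M)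
    (g k : higsonAlgebra M')
    (hg : ∀ y, (φ g : M →ᵇ ℂ) y = ((min (dist x y) 1 : ℝ) : ℂ))
    (hk : ∀ ε > (0 : ℝ), ∃ y, ‖(g : M' →ᵇ ℂ) y‖ < ε ∧ (k : M' →ᵇ ℂ) y = 0) :
    (φ k : M →ᵇ ℂ) x = 0 := by
  by_contra hne
  have hpos : 0 < ‖(φ k : M →ᵇ ℂ) x‖ := norm_pos_iff.2 hne
  have hnear : ∀ᶠ y in 𝓝 x, ‖(φ k : M →ᵇ ℂ) x‖ / 2 < ‖(φ k : M →ᵇ ℂ) y‖ :=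
    (φ k : M →ᵇ ℂ).continuous.norm.continuousAt.eventually (lt_mem_nhds (half_lt_self hpos))
  obtain ⟨η, hη, hball⟩ := Metric.eventually_nhds_iff.1 hnear
  -- Within `η` of `x` the function `φ k` is large; farther away the truncated distance is at least
  -- `min η 1`.
  obtain ⟨u, v, huv⟩ := exists_add_eq_one (φ g) (φ k)
    (δ := min (min η 1) (‖(φ k : M →ᵇ ℂ) x‖ / 2)) (by positivity) (fun y => by
      rcases lt_or_ge (dist y x) η with h | h
      · exact Or.inr ((min_le_right _ _).trans (hball h).le)
      · left
        rw [hg, Complex.norm_real, Real.norm_of_nonneg (by positivity), dist_comm]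
        exact (min_le_left _ _).trans (min_le_min_right 1 h))
  have huv' : φ.symm u * g + φ.symm v * k = 1 := by
    apply φ.injective
    simpa using huv
  let w : M' →ᵇ ℂ := ((φ.symm u : higsonAlgebra M') : M' →ᵇ ℂ)
  obtain ⟨y, hy, hky⟩ := hk (‖w‖ + 1)⁻¹ (by positivity)
  have h1 : w y * (g : M' →ᵇ ℂ) y + ((φ.symm v : higsonAlgebra M') : M' →ᵇ ℂ) y *
      (k : M' →ᵇ ℂ) y = 1 :=
    DFunLike.congr_fun (congrArg Subtype.val huv') y
  rw [hky, mul_zero, add_zero] at h1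
  have h2 : ‖w y‖ * ‖(g : M' →ᵇ ℂ) y‖ = 1 := by rw [← norm_mul, h1, norm_one]
  have h3 : ‖w y‖ * ‖(g : M' →ᵇ ℂ) y‖ ≤ ‖w‖ * (‖w‖ + 1)⁻¹ := by
    gcongr
    exact w.norm_coe_le_norm y
  have h4 : ‖w‖ * (‖w‖ + 1)⁻¹ < 1 := by
    rw [← div_eq_mul_inv, div_lt_one (by positivity)]
    linarith
  linarith

/-- An isomorphism of Higson algebras pulls evaluations back to evaluations. -/
theorem exists_point [ProperSpace M] [ProperSpace M']
    (φ : higsonAlgebra M' ≃ₐ[ℂ] higsonAlgebra M) (x : M) :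
    ∃ y : M', ∀ f : higsonAlgebra M', (φ f : M →ᵇ ℂ) x = (f : M' →ᵇ ℂ) y := by
  obtain ⟨t, ht⟩ := exists_truncated_dist x
  obtain ⟨g, rfl⟩ := φ.surjective t
  by_cases hz : ∃ y, (g : M' →ᵇ ℂ) y = 0
  · obtain ⟨y, hy⟩ := hz
    refine ⟨y, fun f => ?_⟩
    have h := apply_eq_zero_of_common_zeros φ x g
      (f - algebraMap ℂ (higsonAlgebra M') ((f : M' →ᵇ ℂ) y)) ht
      (fun ε hε => ⟨y, by rwa [hy, norm_zero], by simp⟩)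
    rw [map_sub, AlgEquiv.commutes] at h
    have h' : (φ f : M →ᵇ ℂ) x - (f : M' →ᵇ ℂ) y = 0 := by simpa using h
    exact sub_eq_zero.1 h'
  exfalso
  push Not at hz
  have hsmall : ∀ n : ℕ, ∃ y, ‖(g : M' →ᵇ ℂ) y‖ < 1 / ((n : ℝ) + 1) := by
    by_contra! hcon
    obtain ⟨n, hn⟩ := hcon
    obtain ⟨u, hu⟩ := exists_mul_eq_one g (by positivity) hn
    have h1 : φ g * φ u = 1 := by rw [← map_mul, hu, map_one]
    have h2 : (φ g : M →ᵇ ℂ) x * (φ u : M →ᵇ ℂ) x = 1 :=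
      DFunLike.congr_fun (congrArg Subtype.val h1) x
    rw [ht, dist_self] at h2
    simp at h2
  choose a ha using hsmall
  have hga : Tendsto (fun n => ‖(g : M' →ᵇ ℂ) (a n)‖) atTop (𝓝 0) :=
    squeeze_zero (fun _ => norm_nonneg _) (fun n => (ha n).le)
      tendsto_one_div_add_atTop_nhds_zero_nat
  have hat : Tendsto a atTop (cocompact M') := by
    refine (hasBasis_cocompact.tendsto_right_iff).2 fun K hK => ?_
    rcases K.eq_empty_or_nonempty with rfl | hKne
    · simp
    obtain ⟨y, -, hmin⟩ := hK.exists_isMinOn hKne (g : M' →ᵇ ℂ).continuous.norm.continuousOn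
    filter_upwards [hga.eventually (gt_mem_nhds (norm_pos_iff.2 (hz y)))] with n hn hmem
    exact absurd (hmin hmem) (not_le.2 hn)
  -- Each `a n` is paired with a later term at distance at least `n`, giving two diverging sequences
  -- along which `g` tends to zero.
  have hτ : ∀ n : ℕ, ∃ m, n ≤ m ∧ (n : ℝ) ≤ dist (a n) (a m) := fun n =>
    ((eventually_ge_atTop n).and (((tendsto_dist_left_cocompact_atTop (a n)).comp
      hat).eventually_ge_atTop (n : ℝ))).exists
  choose τ hτn hτd using hτ
  have hτt : Tendsto τ atTop atTop := tendsto_atTop_mono hτn tendsto_id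
  obtain ⟨f, hf⟩ := exists_separating a (a ∘ τ) hat (hat.comp hτt)
    (tendsto_atTop_mono hτd tendsto_natCast_atTop_atTop)
  have h0 : (φ f : M →ᵇ ℂ) x = 0 := apply_eq_zero_of_common_zeros φ x g f ht fun ε hε => by
    obtain ⟨n, hn, hn'⟩ := (hf.and_eventually (hga.eventually (gt_mem_nhds hε))).exists
    exact ⟨a n, hn', hn.1⟩
  have h1 : (φ (f - 1) : M →ᵇ ℂ) x = 0 :=
    apply_eq_zero_of_common_zeros φ x g (f - 1) ht fun ε hε => by
      obtain ⟨n, hn, hn'⟩ :=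
        (hf.and_eventually ((hga.comp hτt).eventually (gt_mem_nhds hε))).exists
      refine ⟨a (τ n), hn', ?_⟩
      change (f : M' →ᵇ ℂ) (a (τ n)) - 1 = 0
      rw [sub_eq_zero]
      exact hn.2
  rw [map_sub, map_one] at h1
  change (φ f : M →ᵇ ℂ) x - 1 = 0 at h1
  rw [h0] at h1
  norm_num at h1

theorem eq_of_forall_higson_eq [ProperSpace M] {x y : M}
    (h : ∀ f : higsonAlgebra M, (f : M →ᵇ ℂ) x = (f : M →ᵇ ℂ) y) : x = y := by
  obtain ⟨f, hf⟩ := exists_truncated_dist x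
  have h1 := h f
  rw [hf, hf, Complex.ofReal_inj, dist_self, min_eq_left zero_le_one] at h1
  by_contra hne
  have : 0 < min (dist x y) 1 := lt_min (dist_pos.2 hne) one_pos
  linarith

/-- The truncated distance to `h x`, composed with `h`, is continuous and vanishes at `x`, so it is
small near `x`. -/
theorem continuous_of_comp_higson [ProperSpace M'] (φ : higsonAlgebra M' → higsonAlgebra M)
    (h : M → M') (hφ : ∀ f x, (φ f : M →ᵇ ℂ) x = (f : M' →ᵇ ℂ) (h x)) : Continuous h := by
  refine continuous_iff_continuousAt.2 fun x => ?_
  obtain ⟨f, hf⟩ := exists_truncated_dist (h x)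
  have hc := (φ f : M →ᵇ ℂ).continuous.norm.tendsto x
  simp only [hφ, hf, Complex.norm_real, dist_self, min_eq_left zero_le_one, norm_zero] at hc
  rw [ContinuousAt, Metric.tendsto_nhds]
  intro ε hε
  filter_upwards [hc.eventually (gt_mem_nhds (lt_min hε one_pos))] with y hy
  rw [Real.norm_of_nonneg (by positivity)] at hy
  rw [dist_comm]
  by_contra! hcon
  exact absurd (min_le_min_right 1 hcon) (not_le.2 hy)

/-- An isomorphism of Higson algebras is the composition with a homeomorphism. -/
theorem exists_homeomorph [ProperSpace M] [ProperSpace M']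
    (φ : higsonAlgebra M' ≃ₐ[ℂ] higsonAlgebra M) :
    ∃ h : M ≃ₜ M', ∀ (f : higsonAlgebra M') (x : M),
      (φ f : M →ᵇ ℂ) x = (f : M' →ᵇ ℂ) (h x) := by
  choose h hh using exists_point φ
  choose k hk using exists_point φ.symm
  refine ⟨⟨⟨h, k, fun x => ?_, fun y => ?_⟩,
    continuous_of_comp_higson φ h fun f x => hh x f,
    continuous_of_comp_higson φ.symm k fun f x => hk x f⟩, fun f x => hh x f⟩
  · refine eq_of_forall_higson_eq fun f => ?_
    rw [← hk, ← hh, AlgEquiv.apply_symm_apply]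
  · refine eq_of_forall_higson_eq fun f => ?_
    rw [← hh, ← hk, AlgEquiv.symm_apply_apply]

/-- A homeomorphism pulling Higson functions back to Higson functions is coarse. -/
theorem isCoarseMap_of_comp_higson [ProperSpace M] [ProperSpace M']
    (φ : higsonAlgebra M' → higsonAlgebra M) (h : M ≃ₜ M')
    (hφ : ∀ f x, (φ f : M →ᵇ ℂ) x = (f : M' →ᵇ ℂ) (h x)) : IsCoarseMap h := by
  refine ⟨fun R hR => ?_, fun B hB => ?_⟩
  · by_contra! hcon
    have hcon' : ∀ n : ℕ, ∃ x z : M, dist x z ≤ R ∧ (n : ℝ) + 1 < dist (h x) (h z) :=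
      fun n => hcon _ (by positivity)
    choose x z hxz hn using hcon'
    -- If one point of a pair lies in `K`, both lie in its compact `R`-thickening, whose image is
    -- bounded; this fails for large `n`.
    have hfar : ∀ K : Set M, IsCompact K → ∀ᶠ n in atTop, x n ∉ K ∧ z n ∉ K := by
      intro K hK
      obtain ⟨D, hD⟩ := Metric.isBounded_iff.1
        ((hK.cthickening (r := R)).image h.continuous).isBounded
      filter_upwards [tendsto_natCast_atTop_atTop.eventually_ge_atTop D] with n hDn
      have key : ¬ (x n ∈ Metric.cthickening R K ∧ z n ∈ Metric.cthickening R K) :=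
        fun hmem => by
          have := hD (Set.mem_image_of_mem h hmem.1) (Set.mem_image_of_mem h hmem.2)
          linarith [hn n]
      exact ⟨fun hx => key ⟨Metric.self_subset_cthickening _ hx,
          Metric.mem_cthickening_of_dist_le _ _ _ _ hx (by rw [dist_comm]; exact hxz n)⟩,
        fun hz => key ⟨Metric.mem_cthickening_of_dist_le _ _ _ _ hz (hxz n),
          Metric.self_subset_cthickening _ hz⟩⟩
    have hx : Tendsto x atTop (cocompact M) :=
      hasBasis_cocompact.tendsto_right_iff.2 fun K hK => (hfar K hK).mono fun _ h => h.1
    have hz : Tendsto z atTop (cocompact M) :=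
      hasBasis_cocompact.tendsto_right_iff.2 fun K hK => (hfar K hK).mono fun _ h => h.2
    have hh : Tendsto h (cocompact M) (cocompact M') := h.isClosedEmbedding.tendsto_cocompact
    obtain ⟨f, hf⟩ := exists_separating (h ∘ x) (h ∘ z) (hh.comp hx) (hh.comp hz)
      (tendsto_atTop_mono (fun n => (by linarith [hn n] : (n : ℝ) ≤ dist (h (x n)) (h (z n))))
        tendsto_natCast_atTop_atTop)
    have hev := hx.eventually ((isHigson_iff_dist _).1 (φ f).2 R (1 / 2) (by norm_num))
    obtain ⟨n, ⟨h0, h1⟩, h2⟩ := (hf.and_eventually hev).exists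
    have h3 := h2 (z n) (hxz n)
    rw [hφ, hφ] at h3
    simp only [Function.comp] at h0 h1
    rw [h0, h1] at h3
    norm_num at h3
  · have hc : IsCompact (h ⁻¹' closure B) := h.isCompact_preimage.2 hB.isCompact_closure
    exact hc.isBounded.subset (Set.preimage_mono subset_closure)

end Points

/-! ### Action on the Higson compactifications. -/

section Characters

variable {M : Type*} {M' : Type*} [MetricSpace M] [MetricSpace M']

/-- A contractive algebra isomorphism of Higson algebras induces a map of the Higson
compactifications. -/
noncomputable def pullbackCharacter (φ : higsonAlgebra M' ≃ₐ[ℂ] higsonAlgebra M)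
    (hφ : ∀ f, ‖φ f‖ ≤ ‖f‖) (χ : HigsonCompactification M) : HigsonCompactification M' :=
  ⟨((WeakDual.toStrongDual (χ : WeakDual ℂ (higsonAlgebra M))).comp
      (LinearMap.mkContinuous φ.toLinearMap 1 fun f => by
        rw [one_mul]; exact hφ f) : higsonAlgebra M' →L[ℂ] ℂ), by
    constructor
    · intro h
      have h1 : χ (φ 1) = 0 := DFunLike.congr_fun h (1 : higsonAlgebra M')
      rw [map_one, map_one] at h1
      exact one_ne_zero h1
    · intro f g
      change χ (φ (f * g)) = χ (φ f) * χ (φ g)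
      rw [map_mul, map_mul]⟩

theorem pullbackCharacter_apply (φ : higsonAlgebra M' ≃ₐ[ℂ] higsonAlgebra M)
    (hφ : ∀ f, ‖φ f‖ ≤ ‖f‖) (χ : HigsonCompactification M) (f : higsonAlgebra M') :
    pullbackCharacter φ hφ χ f = χ (φ f) := rfl

theorem continuous_pullbackCharacter (φ : higsonAlgebra M' ≃ₐ[ℂ] higsonAlgebra M)
    (hφ : ∀ f, ‖φ f‖ ≤ ‖f‖) : Continuous (pullbackCharacter φ hφ) := by
  refine Continuous.subtype_mk (WeakDual.continuous_of_continuous_eval fun f => ?_) _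
  exact (WeakDual.eval_continuous (φ f)).comp continuous_subtype_val

/-- The homeomorphism of Higson compactifications induced by an isometric isomorphism. -/
noncomputable def pullbackHomeomorph (φ : higsonAlgebra M' ≃ₐ[ℂ] higsonAlgebra M)
    (hφ : ∀ f, ‖φ f‖ ≤ ‖f‖) (hφ' : ∀ f, ‖φ.symm f‖ ≤ ‖f‖) :
    HigsonCompactification M ≃ₜ HigsonCompactification M' where
  toFun := pullbackCharacter φ hφ
  invFun := pullbackCharacter φ.symm hφ'
  left_inv χ := by
    refine DFunLike.ext _ _ fun f => ?_
    rw [pullbackCharacter_apply, pullbackCharacter_apply, AlgEquiv.apply_symm_apply]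
  right_inv χ := by
    refine DFunLike.ext _ _ fun f => ?_
    rw [pullbackCharacter_apply, pullbackCharacter_apply, AlgEquiv.symm_apply_apply]
  continuous_toFun := continuous_pullbackCharacter φ hφ
  continuous_invFun := continuous_pullbackCharacter φ.symm hφ'

theorem norm_apply_le_of_comp (φ : higsonAlgebra M' → higsonAlgebra M) (h : M → M')
    (hφ : ∀ f x, (φ f : M →ᵇ ℂ) x = (f : M' →ᵇ ℂ) (h x)) (f : higsonAlgebra M') :
    ‖φ f‖ ≤ ‖f‖ := by
  refine (BoundedContinuousFunction.norm_le (norm_nonneg _)).2 fun x => ?_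
  change ‖(φ f : M →ᵇ ℂ) x‖ ≤ ‖(f : M' →ᵇ ℂ)‖
  rw [hφ]
  exact (f : M' →ᵇ ℂ).norm_coe_le_norm _

end Characters

/-! ### From coarse equivalence to bi-Lipschitz nets. -/

section QuasiIsometry

variable {M : Type*} {M' : Type*} [MetricSpace M] [MetricSpace M']

/-- A uniformly expansive map grows at most linearly with the length of a chain of bounded
steps. -/
theorem dist_map_le_of_chain (h : M → M') {c S : ℝ} (hc : 0 < c) (hS : 0 < S)
    (hh : ∀ x z, dist x z ≤ 2 * c → dist (h x) (h z) ≤ S) (x : ℕ → M) (n : ℕ)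
    (hx : ∀ k < n, dist (x k) (x (k + 1)) ≤ c) :
    dist (h (x 0)) (h (x n)) ≤
      S * ((∑ k ∈ Finset.range n, dist (x k) (x (k + 1))) / c) + S := by
  set L : ℕ → ℝ := fun j => ∑ k ∈ Finset.range j, dist (x k) (x (k + 1)) with hL
  have hdist : ∀ i j, i ≤ j → dist (x i) (x j) ≤ L j - L i := by
    intro i j hij
    rw [hL, ← Finset.sum_Ico_eq_sub _ hij]
    exact dist_le_Ico_sum_dist x hij
  -- Greedy subdivision: `i` is the last breakpoint, a new one being placed once the length since
  -- `i` exceeds `c`. Each jump spans at most `2 * c` and costs `S`, and there are at most `L i / c`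
  -- of them.
  have key : ∀ j ≤ n, ∃ i ≤ j, dist (h (x 0)) (h (x i)) ≤ S * (L i / c) ∧ L j - L i ≤ c := by
    intro j
    induction j with
    | zero => exact fun _ => ⟨0, le_rfl, by simp [hL], by simpa using hc.le⟩
    | succ j ih =>
      intro hj
      obtain ⟨i, hij, h1, h2⟩ := ih (by omega)
      have hstep : L (j + 1) = L j + dist (x j) (x (j + 1)) := Finset.sum_range_succ _ _
      have hxj := hx j (by omega)
      rcases le_or_gt (L (j + 1) - L i) c with h3 | h3
      · exact ⟨i, by omega, h1, h3⟩
      · refine ⟨j + 1, le_rfl, ?_, by simpa using hc.le⟩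
        have h4 : dist (h (x i)) (h (x (j + 1))) ≤ S :=
          hh _ _ ((hdist i (j + 1) (by omega)).trans (by linarith))
        have h5 : L i / c + 1 ≤ L (j + 1) / c := by
          rw [div_add_one hc.ne']
          gcongr
          linarith
        have h6 := mul_le_mul_of_nonneg_left h5 hS.le
        have := dist_triangle (h (x 0)) (h (x i)) (h (x (j + 1)))
        linarith
  obtain ⟨i, hi, h1, h2⟩ := key n le_rfl
  have h3 : dist (h (x i)) (h (x n)) ≤ S := hh _ _ ((hdist i n hi).trans (by linarith))
  have h4 : L i ≤ L n := by linarith [hdist i n hi, dist_nonneg (x := x i) (y := x n)]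
  have h5 : S * (L i / c) ≤ S * (L n / c) := by gcongr
  have := dist_triangle (h (x 0)) (h (x i)) (h (x n))
  linarith

/-- Uniformly expansive maps on coarsely quasi-convex spaces are Lipschitz at large scale. -/
theorem UniformlyExpansive.exists_affine_bound {h : M → M'} (hh : UniformlyExpansive h)
    (hM : CoarselyQuasiConvex M) :
    ∃ α > (0 : ℝ), ∃ β > (0 : ℝ), ∀ x y, dist (h x) (h y) ≤ α * dist x y + β := by
  obtain ⟨a, ha, b, hb, c, hc, hchain⟩ := hM
  obtain ⟨S, hS, hSh⟩ := hh (2 * c) (by positivity)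
  refine ⟨S * (a / c), by positivity, S * (b / c) + S, by positivity, fun p q => ?_⟩
  obtain ⟨n, x, rfl, rfl, hstep, hsum⟩ := hchain p q
  refine (dist_map_le_of_chain h hc hS hSh x n hstep).trans ?_
  have h1 : S * ((∑ k ∈ Finset.range n, dist (x k) (x (k + 1))) / c) ≤
      S * ((a * dist (x 0) (x n) + b) / c) := by gcongr
  have h2 : S * ((a * dist (x 0) (x n) + b) / c) =
      S * (a / c) * dist (x 0) (x n) + S * (b / c) := by ring
  linarith

/-- By maximality: a point farther than `D` from a maximal `D`-separated set could be added to it.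
-/
theorem exists_separated_net (X : Type*) [MetricSpace X] {D : ℝ} (hD : 0 < D) :
    ∃ A : Set X, A.Pairwise (fun x y => D ≤ dist x y) ∧ ∀ x, ∃ a ∈ A, dist x a ≤ D := by
  obtain ⟨A, hA⟩ := zorn_subset {A : Set X | A.Pairwise fun x y => D ≤ dist x y}
    (fun c hc hchain => ⟨⋃₀ c,
      (Set.pairwise_sUnion hchain.directedOn).2 fun s hs => hc hs,
      fun s hs => Set.subset_sUnion_of_mem hs⟩)
  refine ⟨A, hA.prop, fun x => ?_⟩
  by_contra! hcon
  have hins : (insert x A).Pairwise fun x y => D ≤ dist x y :=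
    Set.pairwise_insert.2 ⟨hA.prop, fun a ha _ =>
      ⟨(hcon a ha).le, by rw [dist_comm]; exact (hcon a ha).le⟩⟩
  have hx : x ∈ A := hA.le_of_ge hins (Set.subset_insert x A) (Set.mem_insert x A)
  have := hcon x hx
  rw [dist_self] at this
  linarith

/-- A coarse bijection with coarse inverse between coarsely quasi-convex spaces restricts to a
coarse quasi-isometry. -/
theorem exists_coarseQuasiIsometry (h : M ≃ M') (hh : UniformlyExpansive h)
    (hh' : UniformlyExpansive h.symm) (hM : CoarselyQuasiConvex M)
    (hM' : CoarselyQuasiConvex M') :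
    ∃ q : CoarseQuasiIsometry M M', ∀ a : q.source, (q.toEquiv a : M') = h a := by
  obtain ⟨α, hα, β, hβ, hup⟩ := hh.exists_affine_bound hM
  obtain ⟨α', hα', β', hβ', hlow⟩ := hh'.exists_affine_bound hM'
  obtain ⟨A, hsep, hnet⟩ := exists_separated_net M (D := 2 * β') (by positivity)
  refine ⟨⟨A, h '' A, ⟨2 * β', by positivity, hnet⟩, ?_, h.image A, ?_⟩, fun a => rfl⟩
  · obtain ⟨S, hS, hSh⟩ := hh (2 * β') (by positivity)
    refine ⟨S, hS, fun y => ?_⟩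
    obtain ⟨a, ha, hd⟩ := hnet (h.symm y)
    refine ⟨h a, Set.mem_image_of_mem h ha, ?_⟩
    have := hSh _ _ hd
    rwa [h.apply_symm_apply] at this
  -- Distinct net points are at least `2 * β'` apart. So `β'` is at most half their distance, which
  -- gives `2 * α'`, and `β` is at most `β / (2 * β')` times it.
  · refine ⟨max 1 (max (2 * α') (α + β / (2 * β'))), le_max_left _ _, fun x y => ?_⟩
    set C := max 1 (max (2 * α') (α + β / (2 * β'))) with hC
    have hC1 : 1 ≤ C := le_max_left _ _
    have hC2 : 2 * α' ≤ C := (le_max_left _ _).trans (le_max_right _ _)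
    have hC3 : α + β / (2 * β') ≤ C := (le_max_right _ _).trans (le_max_right _ _)
    change 1 / C * dist (x : M) y ≤ dist (h x) (h y) ∧ dist (h x) (h y) ≤ C * dist (x : M) y
    rcases eq_or_ne x y with rfl | hne
    · simp
    have hD : 2 * β' ≤ dist (x : M) y := hsep x.2 y.2 (Subtype.coe_injective.ne hne)
    constructor
    · have h1 := hlow (h x) (h y)
      rw [h.symm_apply_apply, h.symm_apply_apply] at h1
      rw [one_div, inv_mul_le_iff₀ (by linarith)]
      have h2 : 2 * α' * dist (h x) (h y) ≤ C * dist (h x) (h y) := by gcongr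
      linarith
    · refine (hup x y).trans ?_
      have h1 : β ≤ β / (2 * β') * dist (x : M) y := by
        rw [div_mul_eq_mul_div, le_div_iff₀ (by positivity)]
        gcongr
      have h2 : (α + β / (2 * β')) * dist (x : M) y ≤ C * dist (x : M) y := by gcongr
      linarith

end QuasiIsometry

end HigsonCoarse

theorem mainTheorem3 {M : Type*} {M' : Type*} [MetricSpace M] [MetricSpace M']
    [ProperSpace M] [ProperSpace M'] (φ : higsonAlgebra M' ≃ₐ[ℂ] higsonAlgebra M) :
    CoarselyEquivalent M M' ∧
    ∃ F : HigsonCompactification M ≃ₜ HigsonCompactification M',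
      (∀ (χ : HigsonCompactification M) (f : higsonAlgebra M'), F χ f = χ (φ f)) ∧
      F '' Set.range (toHigson : M → HigsonCompactification M) =
        Set.range (toHigson : M' → HigsonCompactification M') ∧
      ∃ h : M ≃ₜ M', (∀ x : M, F (toHigson x) = toHigson (h x)) ∧
        IsCoarseEquivalence h ∧
        (CoarselyQuasiConvex M → CoarselyQuasiConvex M' →
          ∃ q : CoarseQuasiIsometry M M', ∀ a : q.source, (q.toEquiv a : M') = h a) := by
  obtain ⟨h, hh⟩ := exists_homeomorph φ
  have hh' : ∀ (f : higsonAlgebra M) (y : M'),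
      (φ.symm f : M' →ᵇ ℂ) y = (f : M →ᵇ ℂ) (h.symm y) := fun f y => by
    rw [← h.apply_symm_apply y, ← hh, AlgEquiv.apply_symm_apply, h.symm_apply_apply]
  have hc : IsCoarseMap h := isCoarseMap_of_comp_higson φ h hh
  have hc' : IsCoarseMap h.symm := isCoarseMap_of_comp_higson φ.symm h.symm hh'
  have hce : IsCoarseEquivalence h :=
    ⟨hc, h.symm, hc', ⟨0, fun x => by simp⟩, ⟨0, fun y => by simp⟩⟩
  let F := pullbackHomeomorph φ (norm_apply_le_of_comp φ h hh)
    (norm_apply_le_of_comp φ.symm h.symm hh')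
  have hF : ∀ x : M, F (toHigson x) = toHigson (h x) := fun x =>
    DFunLike.ext _ _ fun f => hh f x
  refine ⟨⟨h, hce⟩, F, fun χ f => rfl, ?_, h, hF, hce, fun hM hM' =>
    exists_coarseQuasiIsometry h.toEquiv hc.uniformlyExpansive hc'.uniformlyExpansive hM hM'⟩
  rw [← Set.range_comp]
  have hcomp : F ∘ (toHigson : M → HigsonCompactification M) = toHigson ∘ h := funext hF
  rw [hcomp, h.surjective.range_comp]
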